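/- **Setting.** Let $\mathcal G$ be an undirected connected graph on $\{1,\dots,N\}$ with symmetric weighted adjacency matrix $(a_{ij})$ ($a_{ij}>0$ if $i,j$ are neighbours, $a_{ij}=0$ otherwise) and Laplacian $L_{\mathcal G}$. Let $A\in\mathbb R^{n\times n}$, $B\in\mathbb R^{n\times w}$, $K\in\mathbb R^{w\times n}$, and let $\Delta>0$ be the sampling period; write $k$ for the time $k\Delta$. $\|\cdot\|$ and $\|\cdot\|_\infty$ denote the Euclidean and the sup norm of vectors and the induced matrix norms, and $\rho$ is the spectral radius. *DoS.* The DoS signal is given by a finite or infinite sequence of off/on times $h_q$ with $h_0\ge\Delta$ and durations $\tau_q\ge 0$, with $h_q+\tau_q<h_{q+1}$; the network is in DoS on $H_q=\{h_q\}\cup[h_q,h_q+\tau_q)$. The transmission attempt at time $k\Delta$, $k\ge1$, fails if and only if $k\Delta\in\bigcup_q H_q$. There are constants $\eta,\kappa\ge0$, $\tau_D>0$, $T>1$ such that for all $t\ge\tau>0$ the number of $q$ with $h_q\in[\tau,t]$ is at most $\eta+(t-\tau)/\tau_D$, and the length of $\bigcup_qH_q\cap[\tau,t]$ is at most $\kappa+(t-\tau)/T$.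 Assume $1/T+\Delta/\tau_D<1$ and put $$M=\left\lfloor \frac{(\kappa+\eta\Delta)(1-1/T-\Delta/\tau_D)^{-1}}{\Delta}\right\rfloor .$$ *Closed loop.* Let $R\ge1$ be an integer and $\sigma>0$. The quantizer is $q_R(\chi)=0$ for $-\sigma<\chi<\sigma$, $q_R(\chi)=2z\sigma$ for $(2z-1)\sigma\le\chi<(2z+1)\sigma$ ($z=1,\dots,R$), $q_R(\chi)=2R\sigma$ for $\chi\ge(2R+1)\sigma$, and $q_R(\chi)=-q_R(-\chi)$ for $\chi\le-\sigma$; $Q_R$ applies $q_R$ to each component. The agents satisfy, for $k\ge1$, $$x_i(k)=Ax_i(k-1)+Bu_i(k-1),\qquad u_i(k)=K\sum_{j}a_{ij}(\hat x_j(k)-\hat x_i(k)),$$ with $\|x_i(0)\|_\infty\le C_{x_0}$, where $C_{x_0}>0$. The estimates and the scaling parameter start from $\hat x_j(0)=0$, $\theta(0)=\theta_0$, and for $k\ge1$: if the transmission at $k$ succeeds, $$\hat x_j(k)=A\hat x_j(k-1)+\theta(k-1)\,Q_R\!\left(\frac{x_j(k)-A\hat x_j(k-1)}{\theta(k-1)}\right),\qquad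 \theta(k)=\gamma_1\theta(k-1);$$ if it fails, $\hat x_j(k)=A\hat x_j(k-1)$ and $\theta(k)=\gamma_2\theta(k-1)$. *Design.* Put $L=L_{\mathcal G}\otimes BK$, $G=I_N\otimes A-L$, $H=I_N\otimes A+L$, $\overline A=\begin{bmatrix}G&L\\-L&H\end{bmatrix}$, and let $\overline A_{ij}(m)$ be the $nN\times nN$ blocks of $\overline A^m$. For $0\le m\le M$ let $$G(m+1)=\frac{G\overline A_{11}(m)+L\overline A_{21}(m)}{\gamma_2^m},\qquad L(m+1)=\frac{G\overline A_{12}(m)+L\overline A_{22}(m)}{\gamma_2^m}.$$ Let $U=[\mathbf 1/\sqrt N\ \phi_2\ \cdots\ \phi_N]$ be an orthogonal matrix with $\phi_i^TL_{\mathcal G}=\lambda_i\phi_i^T$, and let $J(m+1)$ be $(U\otimes I_n)^TG(m+1)(U\otimes I_n)$ with the first $n$ rows and columns deleted; in particular $J(1)=\mathrm{diag}(A-\lambda_2BK,\dots,A-\lambda_NBK)$. Suppose $\rho(J(1))<d_0<1$ and $C_2\ge1$ satisfy $\|J(1)^p\|\le C_2d_0^p$ for all integers $p\ge1$, and that $\gamma_1,\gamma_2,\theta_0$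 satisfy $$d_0<\gamma_1<1,\qquad \gamma_2>0,\qquad \max_{1\le m\le M}\|J(m+1)\|\le \rho(J(1))/C_2,\qquad \theta_0\ge C_{x_0}\gamma_1/\sigma$$ (the condition on the maximum is void if $M=0$). Put $d=d_0/\gamma_1$, $C_0=\max_{0\le m\le M}\|L(m+1)\|$, $\zeta=\max_{0\le m\le M}\|(\overline A/\gamma_2)^m\|$ and $$C_1=\max\left\{2C_2\sqrt{Nn},\ \frac{C_0C_2\sqrt{Nn}}{(1-d)\gamma_1}\right\}.$$ **Theorem.** If $2R+1\ \ge\ \|[-L\ \ H]\|_\infty\,\zeta\,\dfrac{\sqrt{C_1^2+Nn}}{\gamma_1}$, then: (i) the quantizer is never overflowed: $\left\|\dfrac{x_j(k)-A\hat x_j(k-1)}{\theta(k-1)}\right\|_\infty\le(2R+1)\sigma$ for all $j$ and all $k\ge1$ (whether or not the transmission at $k$ succeeds); (ii) if in addition $\dfrac1T+\dfrac{\Delta}{\tau_D}<\dfrac{-\ln\gamma_1}{\ln\gamma_2-\ln\gamma_1}$, then $\|x_i(k)-\bar x(k)\|_\infty\to0$ as $k\to\infty$ for every $i$, where $\bar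 x(k)=\frac1N\sum_{i=1}^Nx_i(k)$. -/

import Mathlib

open scoped Matrix Kronecker Topology

noncomputable section

namespace QuantizedConsensus

/-! ### Matrix norms and the spectral radius -/

section
open scoped Matrix.Norms.L2Operator

/-- The matrix norm induced by the Euclidean vector norms. -/
def norm2 {ι κ : Type*} [Fintype ι] [Fintype κ] [DecidableEq κ] (X : Matrix ι κ ℝ) : ℝ := ‖X‖

end

section
open scoped Matrix.Norms.Operator

/-- The matrix norm induced by the sup norms of vectors (the largest absolute row sum). -/
def normInf {ι κ : Type*} [Fintype ι] [Fintype κ] (X : Matrix ι κ ℝ) : ℝ := ‖X‖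

end

/-- The spectral radius of a real square matrix: the largest modulus of its complex eigenvalues
(and `0` for the empty matrix). -/
def specRadius {ι : Type*} [Fintype ι] [DecidableEq ι] (X : Matrix ι ι ℝ) : ℝ :=
  (spectralRadius ℂ (X.map (algebraMap ℝ ℂ))).toReal

/-! ### The communication graph -/

/-- `a` is a (weighted) adjacency matrix of the undirected graph `𝒢`. -/
structure IsAdjacency {N : ℕ} (𝒢 : SimpleGraph (Fin N)) (a : Matrix (Fin N) (Fin N) ℝ) :
    Prop where
  symm : ∀ i j, a i j = a j i
  pos : ∀ i j, 𝒢.Adj i j → 0 < a i j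
  zero : ∀ i j, ¬ 𝒢.Adj i j → a i j = 0

/-- The Laplacian matrix of the adjacency matrix `a`. -/
def laplacian {N : ℕ} (a : Matrix (Fin N) (Fin N) ℝ) : Matrix (Fin N) (Fin N) ℝ :=
  Matrix.of fun i j => if i = j then ∑ l, a i l else - a i j

/-- `U = [𝟏/√N, φ₂, …, φ_N]` is orthogonal, and its columns other than the first one are
(left) eigenvectors of the Laplacian of `a`. -/
structure IsEigenbasis {N : ℕ} [NeZero N] (a U : Matrix (Fin N) (Fin N) ℝ) : Prop where
  orthogonal : Uᵀ * U = 1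
  first : ∀ i, U i 0 = 1 / √(N : ℝ)
  eigen : ∀ j, j ≠ 0 → ∃ lam : ℝ, U.col j ᵥ* laplacian a = lam • U.col j

/-! ### Denial-of-service signals -/

/-- A DoS signal on a network with sampling period `Δ`: a finite or infinite sequence (of length
`num`) of off/on transition times `start q` (the first not before `Δ`) and durations `len q`.
The values of `start` and `len` at indices `q ≥ num` are irrelevant. -/
structure DoS (Δ : ℝ) where
  num : ℕ∞
  start : ℕ → ℝ
  len : ℕ → ℝ
  start_zero : 0 < num → Δ ≤ start 0
  len_nonneg : ∀ q : ℕ, (q : ℕ∞) < num → 0 ≤ len q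
  start_succ : ∀ q : ℕ, ((q + 1 : ℕ) : ℕ∞) < num → start q + len q < start (q + 1)

namespace DoS

variable {Δ : ℝ} (D : DoS Δ)

/-- The `q`-th DoS interval `{h_q} ∪ [h_q, h_q + τ_q[`. -/
def interval (q : ℕ) : Set ℝ := {D.start q} ∪ Set.Ico (D.start q) (D.start q + D.len q)

/-- The set of times at which the network is in DoS status. -/
def active : Set ℝ := {t | ∃ q : ℕ, (q : ℕ∞) < D.num ∧ t ∈ D.interval q}

/-- The transmission attempt at time `kΔ` fails. -/
def Fails (k : ℕ) : Prop := (k : ℝ) * Δ ∈ D.active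

/-- The indices of the off/on transitions over `[τ, t]`. -/
def transitions (τ t : ℝ) : Set ℕ := {q | (q : ℕ∞) < D.num ∧ D.start q ∈ Set.Icc τ t}

/-- DoS frequency: finitely many transitions over `[τ, t]`, at most `η + (t - τ) / τD`. -/
def FrequencyBound (η τD : ℝ) : Prop :=
  ∀ τ t : ℝ, 0 < τ → τ ≤ t →
    (D.transitions τ t).Finite ∧ ((D.transitions τ t).ncard : ℝ) ≤ η + (t - τ) / τD

/-- DoS duration: total length over `[τ, t]` at most `κ + (t - τ) / T`. -/
def DurationBound (κ T : ℝ) : Prop :=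
  ∀ τ t : ℝ, 0 < τ → τ ≤ t →
    MeasureTheory.volume.real (D.active ∩ Set.Icc τ t) ≤ κ + (t - τ) / T

end DoS

/-- The bound `M` on the number of consecutive failed transmissions. -/
def maxFail (Δ η τD κ T : ℝ) : ℕ :=
  ⌊(κ + η * Δ) * (1 - 1 / T - Δ / τD)⁻¹ / Δ⌋₊

/-! ### The quantizer -/

/-- The quantizer on arguments `χ > -σ`. On `σ ≤ χ < (2R+1)σ` the integer
`z = ⌊(χ/σ + 1)/2⌋` is the one with `(2z-1)σ ≤ χ < (2z+1)σ`. -/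
def quantPos (R : ℕ) (σ χ : ℝ) : ℝ :=
  if χ < σ then 0
  else if χ < (2 * R + 1) * σ then 2 * (⌊(χ / σ + 1) / 2⌋ : ℝ) * σ
  else 2 * R * σ

/-- The uniform quantizer with `2R+1` levels, extended to `χ ≤ -σ` by oddness. -/
def quant (R : ℕ) (σ χ : ℝ) : ℝ :=
  if χ ≤ -σ then - quantPos R σ (-χ) else quantPos R σ χ

/-- The quantizer applied to each component. -/
def quantVec {n : ℕ} (R : ℕ) (σ : ℝ) (v : Fin n → ℝ) : Fin n → ℝ := fun c => quant R σ (v c)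

/-! ### The closed loop -/

section ClosedLoop

variable {Δ : ℝ} {N n w : ℕ}

open Classical in
/-- The scaling parameter `θ(k)`. -/
def theta (D : DoS Δ) (γ₁ γ₂ θ₀ : ℝ) : ℕ → ℝ
  | 0 => θ₀
  | k + 1 => if D.Fails (k + 1) then γ₂ * theta D γ₁ γ₂ θ₀ k else γ₁ * theta D γ₁ γ₂ θ₀ k

/-- The control input `u_i = K ∑ⱼ a_ij (x̂_j - x̂_i)`. -/
def control (a : Matrix (Fin N) (Fin N) ℝ) (K : Matrix (Fin w) (Fin n) ℝ)
    (xhat : Fin N → Fin n → ℝ) (i : Fin N) : Fin w → ℝ :=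
  K *ᵥ ∑ j, a i j • (xhat j - xhat i)

open Classical in
/-- The pair of the states `x(k)` of the agents and their estimates `x̂(k)`. -/
def closedLoop (D : DoS Δ) (a : Matrix (Fin N) (Fin N) ℝ) (A : Matrix (Fin n) (Fin n) ℝ)
    (B : Matrix (Fin n) (Fin w) ℝ) (K : Matrix (Fin w) (Fin n) ℝ) (R : ℕ)
    (σ γ₁ γ₂ θ₀ : ℝ) (x₀ : Fin N → Fin n → ℝ) :
    ℕ → (Fin N → Fin n → ℝ) × (Fin N → Fin n → ℝ)
  | 0 => (x₀, 0)
  | k + 1 =>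
    let p := closedLoop D a A B K R σ γ₁ γ₂ θ₀ x₀ k
    let θ := theta D γ₁ γ₂ θ₀ k
    let x : Fin N → Fin n → ℝ := fun i => A *ᵥ p.1 i + B *ᵥ control a K p.2 i
    (x, fun j =>
      if D.Fails (k + 1) then A *ᵥ p.2 j
      else A *ᵥ p.2 j + θ • quantVec R σ (θ⁻¹ • (x j - A *ᵥ p.2 j)))

/-- The average of the states. -/
def average (x : Fin N → Fin n → ℝ) : Fin n → ℝ := (N : ℝ)⁻¹ • ∑ i, x i

end ClosedLoop

/-! ### The matrices and constants of the design -/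

section Design

variable {N n w : ℕ} (a : Matrix (Fin N) (Fin N) ℝ) (A : Matrix (Fin n) (Fin n) ℝ)
  (B : Matrix (Fin n) (Fin w) ℝ) (K : Matrix (Fin w) (Fin n) ℝ)

/-- `L = L_𝒢 ⊗ BK`. -/
def matL : Matrix (Fin N × Fin n) (Fin N × Fin n) ℝ := laplacian a ⊗ₖ (B * K)

/-- `G = I ⊗ A - L_𝒢 ⊗ BK`. -/
def matG : Matrix (Fin N × Fin n) (Fin N × Fin n) ℝ :=
  (1 : Matrix (Fin N) (Fin N) ℝ) ⊗ₖ A - laplacian a ⊗ₖ (B * K)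

/-- `H = I ⊗ A + L_𝒢 ⊗ BK`. -/
def matH : Matrix (Fin N × Fin n) (Fin N × Fin n) ℝ :=
  (1 : Matrix (Fin N) (Fin N) ℝ) ⊗ₖ A + laplacian a ⊗ₖ (B * K)

/-- `Ā = [G, L; -L, H]`. -/
def matAbar : Matrix ((Fin N × Fin n) ⊕ (Fin N × Fin n)) ((Fin N × Fin n) ⊕ (Fin N × Fin n)) ℝ :=
  Matrix.fromBlocks (matG a A B K) (matL a B K) (-matL a B K) (matH a A B K)

/-- `G(m+1) = (G Ā₁₁(m) + L Ā₂₁(m)) / γ₂^m`, as a function of `m`. -/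
def matGsucc (γ₂ : ℝ) (m : ℕ) : Matrix (Fin N × Fin n) (Fin N × Fin n) ℝ :=
  (γ₂ ^ m)⁻¹ • (matG a A B K * (matAbar a A B K ^ m).toBlocks₁₁
    + matL a B K * (matAbar a A B K ^ m).toBlocks₂₁)

/-- `L(m+1) = (G Ā₁₂(m) + L Ā₂₂(m)) / γ₂^m`, as a function of `m`. -/
def matLsucc (γ₂ : ℝ) (m : ℕ) : Matrix (Fin N × Fin n) (Fin N × Fin n) ℝ :=
  (γ₂ ^ m)⁻¹ • (matG a A B K * (matAbar a A B K ^ m).toBlocks₁₂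
    + matL a B K * (matAbar a A B K ^ m).toBlocks₂₂)

/-- `J(m+1)`, as a function of `m`: the matrix `(U ⊗ I)ᵀ G(m+1) (U ⊗ I)` without its first `n`
rows and columns. For `m = 0` this is `diag(A - λ₂BK, …, A - λ_N BK)`, where `λ_j` is the
eigenvalue of the Laplacian that belongs to the `j`-th column of `U`. -/
def matJsucc [NeZero N] (U : Matrix (Fin N) (Fin N) ℝ) (γ₂ : ℝ) (m : ℕ) :
    Matrix ({i : Fin N // i ≠ 0} × Fin n) ({i : Fin N // i ≠ 0} × Fin n) ℝ :=
  ((U ⊗ₖ (1 : Matrix (Fin n) (Fin n) ℝ))ᵀ * matGsucc a A B K γ₂ m *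
    (U ⊗ₖ (1 : Matrix (Fin n) (Fin n) ℝ))).submatrix
      (fun p => (p.1.1, p.2)) (fun p => (p.1.1, p.2))

/-- `C₀ = max_{m = 0, …, M} ‖L(m+1)‖`. -/
def constC0 (γ₂ : ℝ) (M : ℕ) : ℝ :=
  (Finset.range (M + 1)).sup' Finset.nonempty_range_add_one
    (fun m => norm2 (matLsucc a A B K γ₂ m))

/-- `ζ = max_{m = 0, …, M} ‖(Ā/γ₂)^m‖`. -/
def constZeta (γ₂ : ℝ) (M : ℕ) : ℝ :=
  (Finset.range (M + 1)).sup' Finset.nonempty_range_add_one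
    (fun m => norm2 ((γ₂⁻¹ • matAbar a A B K) ^ m))

/-- `C₁ = max {2 C₂ √(Nn), C₀ C₂ √(Nn) / ((1 - d) γ₁)}` with `d = d₀ / γ₁`. -/
def constC1 (γ₁ γ₂ d₀ C₂ : ℝ) (M : ℕ) : ℝ :=
  max (2 * C₂ * √((N : ℝ) * n))
    (constC0 a A B K γ₂ M * C₂ * √((N : ℝ) * n) / ((1 - d₀ / γ₁) * γ₁))

end Design

end QuantizedConsensus

end

namespace QuantizedConsensus

/-! ### Failed transmissions under a DoS signal -/

namespace DoS

open MeasureTheory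

variable {Δ : ℝ} (D : DoS Δ)

/-! Let `z` stack the deviations of the states from their average and the estimation errors. At a
failed transmission `z` is multiplied by `Ā`, with no quantizer involved. At a success after `m`
failures, the deviation is the block row `[G L]` applied to `Ā ^ m` times the last post-success `z`,
and the error is a pure quantization error, of size at most `σ` times the old scaling parameter,
provided the quantizer has not overflowed.

In the coordinates orthogonal to consensus, the deviation thus obeys a switched system with matrices
`J m`, driven by the bounded errors. Its stability comes from a norm-like quantity adapted to all
products (`DecaysFrom`): every `J m` contracts it by `d₀` exactly (`DecaysFrom.mulVec`), while a new
input costs the factor `C₂` only once (`DecaysFrom.of_euclNorm_le`, resting on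
`norm2_pow_mul_prod_le`). The constant `C₁` makes the resulting bound proportional to the scaling
parameter reproduce itself. The condition on `R` turns this bound into absence of overflow at the
next attempt, which closes the induction.

The DoS bounds enter twice, through one measure estimate (`volume_le_of_cover`): `le_maxFail` keeps
`m ≤ M`, and `failCount_le` bounds the density of failures. The latter drives the scaling parameter
to zero (`tendsto_theta`), and `z`, being bounded by a multiple of it, follows. -/

theorem start_add_len_lt {q r : ℕ} (hqr : q < r) (hr : (r : ℕ∞) < D.num) :
    D.start q + D.len q < D.start r := by
  induction r, hqr using Nat.le_induction with
  | base => exact D.start_succ q hr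
  | succ r hqr ih =>
    have hr' : (r : ℕ∞) < D.num := lt_trans (by exact_mod_cast r.lt_succ_self) hr
    linarith [ih hr', D.start_succ r hr, D.len_nonneg r hr']

theorem period_le_start {q : ℕ} (hq : (q : ℕ∞) < D.num) : Δ ≤ D.start q := by
  have h0 : (0 : ℕ∞) < D.num := lt_of_le_of_lt (by simp) hq
  rcases Nat.eq_zero_or_pos q with rfl | hpos
  · exact D.start_zero h0
  · linarith [D.start_zero h0, D.len_nonneg 0 (by simpa using h0), D.start_add_len_lt hpos hq]

/-- A bounded set covered by the DoS intervals prolonged by one sampling period is short. -/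
theorem volume_le_of_cover {η τD κ T : ℝ} (hΔ : 0 < Δ) (hfreq : D.FrequencyBound η τD)
    (hdur : D.DurationBound κ T) {τ t : ℝ} (hτ : 0 < τ) (hτt : τ ≤ t) {X : Set ℝ}
    (hX : X ⊆ Set.Icc τ t)
    (hcov : ∀ y ∈ X, ∃ q : ℕ, (q : ℕ∞) < D.num ∧ τ ≤ D.start q ∧ D.start q ≤ y ∧
      y < D.start q + D.len q + Δ) :
    volume.real X ≤ κ + (t - τ) / T + Δ * (η + (t - τ) / τD) := by
  obtain ⟨hfin, hcard⟩ := hfreq τ t hτ hτt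
  -- Each point lies either in a DoS interval, charged to the duration bound, or in a tail of length
  -- `Δ` behind one, charged to the frequency bound.
  have hsub : X ⊆ (D.active ∩ Set.Icc τ t) ∪ ⋃ q ∈ hfin.toFinset,
      Set.Ico (D.start q + D.len q) (D.start q + D.len q + Δ) := by
    intro y hy
    obtain ⟨q, hq, h1, h2, h3⟩ := hcov y hy
    by_cases hlt : y < D.start q + D.len q
    · exact Or.inl ⟨⟨q, hq, Or.inr ⟨h2, hlt⟩⟩, hX hy⟩
    · refine Or.inr (Set.mem_biUnion (x := q) ?_ ⟨not_lt.1 hlt, h3⟩)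
      simpa using ⟨hq, h1, h2.trans (hX hy).2⟩
  have hA : volume (D.active ∩ Set.Icc τ t) ≠ ⊤ :=
    measure_ne_top_of_subset Set.inter_subset_right (by simp)
  have hB : volume (⋃ q ∈ hfin.toFinset,
      Set.Ico (D.start q + D.len q) (D.start q + D.len q + Δ)) ≠ ⊤ :=
    (measure_biUnion_lt_top hfin.toFinset.finite_toSet (by simp)).ne
  calc volume.real X
      ≤ volume.real (D.active ∩ Set.Icc τ t) + volume.real (⋃ q ∈ hfin.toFinset,
          Set.Ico (D.start q + D.len q) (D.start q + D.len q + Δ)) :=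
        (measureReal_mono hsub (measure_union_ne_top hA hB)).trans (measureReal_union_le _ _)
    _ ≤ volume.real (D.active ∩ Set.Icc τ t) + ∑ q ∈ hfin.toFinset,
          volume.real (Set.Ico (D.start q + D.len q) (D.start q + D.len q + Δ)) := by
        gcongr
        exact measureReal_biUnion_finset_le _ _
    _ = volume.real (D.active ∩ Set.Icc τ t) + Δ * ((D.transitions τ t).ncard : ℝ) := by
        simp [hΔ.le, Set.ncard_eq_toFinset_card _ hfin, mul_comm]
    _ ≤ _ := by
        gcongr
        exact hdur τ t hτ hτt

/-- Closing the right end absorbs the isolated point of an interval of length zero. -/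
theorem exists_interval_of_fails {k : ℕ} (hk : D.Fails k) :
    ∃ q : ℕ, (q : ℕ∞) < D.num ∧ D.start q ≤ k * Δ ∧ k * Δ ≤ D.start q + D.len q := by
  obtain ⟨q, hq, h | h⟩ := hk
  · have h' : (k : ℝ) * Δ = D.start q := h
    exact ⟨q, hq, h'.ge, by linarith [D.len_nonneg q hq]⟩
  · exact ⟨q, hq, h.1, h.2.le⟩

/-- The number of consecutive failed transmissions is at most `M`. -/
theorem le_maxFail {η τD κ T : ℝ} (hΔ : 0 < Δ) (hfreq : D.FrequencyBound η τD)
    (hdur : D.DurationBound κ T) (hDoS : 1 / T + Δ / τD < 1) {s m : ℕ}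
    (hfail : ∀ i, s < i → i ≤ s + m → D.Fails i) : m ≤ maxFail Δ η τD κ T := by
  rcases Nat.eq_zero_or_pos m with rfl | hm
  · exact Nat.zero_le _
  obtain ⟨q₀, hq₀, hs₀, hs₀'⟩ := D.exists_interval_of_fails (hfail (s + 1) (by omega) (by omega))
  have hpos : 0 < D.start q₀ := hΔ.trans_le (D.period_le_start hq₀)
  set τ := D.start q₀ with hτ
  set t : ℝ := ((s + m + 1 : ℕ) : ℝ) * Δ with ht
  have hmt : (m : ℝ) * Δ ≤ t - τ := by
    have : ((s + 1 : ℕ) : ℝ) * Δ + m * Δ = t := by rw [ht]; push_cast; ring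
    linarith
  have hmΔ : 0 ≤ (m : ℝ) * Δ := by positivity
  have hvol := D.volume_le_of_cover hΔ hfreq hdur hpos (by linarith : τ ≤ t)
    (X := Set.Ico τ t) Set.Ico_subset_Icc_self (by
      intro y hy
      -- Before the first failed attempt, `q₀` itself covers `y`. Afterwards the last sampling time
      -- before `y` is a failed one, and its interval prolonged by `Δ` reaches past `y`.
      by_cases hys : y < ((s + 1 : ℕ) : ℝ) * Δ
      · exact ⟨q₀, hq₀, le_rfl, hy.1, by linarith⟩
      set k := ⌊y / Δ⌋₊ with hk
      have hy0 : 0 ≤ y / Δ := div_nonneg (hpos.le.trans hy.1) hΔ.le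
      have hky : (k : ℝ) * Δ ≤ y := (le_div_iff₀ hΔ).1 (Nat.floor_le hy0)
      have hyk : y < (k : ℝ) * Δ + Δ := by
        have := (div_lt_iff₀ hΔ).1 (Nat.lt_floor_add_one (y / Δ))
        rw [← hk] at this
        linarith
      have hsk : s + 1 ≤ k := Nat.le_floor ((le_div_iff₀ hΔ).2 (not_lt.1 hys))
      have hkm : k < s + m + 1 := (Nat.floor_lt hy0).2 ((div_lt_iff₀ hΔ).2 hy.2)
      obtain ⟨q, hq, h1, h2⟩ := D.exists_interval_of_fails (hfail k (by omega) (by omega))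
      refine ⟨q, hq, ?_, h1.trans hky, by linarith⟩
      -- An interval earlier than `q₀` ends before the first failed attempt, so it cannot contain `k
      -- * Δ`.
      rcases lt_trichotomy q q₀ with h | h | h
      · have := D.start_add_len_lt h hq₀
        have : ((s + 1 : ℕ) : ℝ) * Δ ≤ k * Δ := by gcongr
        linarith
      · rw [h]
      · linarith [D.start_add_len_lt h hq, D.len_nonneg q₀ hq₀])
  -- The covered set is all of `[τ, t)`, so `t - τ` is bounded by an affine function of itself with
  -- slope less than one; solving for it gives `M`.
  rw [Real.volume_real_Ico_of_le (by linarith)] at hvol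
  have hc : 0 < 1 - 1 / T - Δ / τD := by linarith
  refine Nat.le_floor ((le_div_iff₀ hΔ).2 (hmt.trans ?_))
  rw [← div_eq_mul_inv, le_div_iff₀ hc]
  have e1 : (t - τ) / T = (t - τ) * (1 / T) := by ring
  have e2 : Δ * ((t - τ) / τD) = (t - τ) * (Δ / τD) := by ring
  nlinarith

open Classical in
/-- The number of failed transmissions up to time `kΔ`. -/
noncomputable def failCount (k : ℕ) : ℕ := Nat.count (fun i => D.Fails (i + 1)) k

/-- Each failed attempt owns the sampling cell that starts at it. These cells are disjoint, have
length `Δ`, and lie in the prolonged DoS intervals. -/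
theorem failCount_le {η τD κ T : ℝ} (hΔ : 0 < Δ) (hfreq : D.FrequencyBound η τD)
    (hdur : D.DurationBound κ T) (k : ℕ) :
    (D.failCount k : ℝ) ≤ (κ + Δ * η) / Δ + k * (1 / T + Δ / τD) := by
  classical
  set S := (Finset.range k).filter (fun i => D.Fails (i + 1)) with hS
  have hcount : D.failCount k = S.card := by
    rw [failCount, Nat.count_eq_card_filter_range]
  have hdisj : Set.PairwiseDisjoint (S : Set ℕ)
      (fun i : ℕ => Set.Ico (((i + 1 : ℕ) : ℝ) * Δ) (((i + 2 : ℕ) : ℝ) * Δ)) := by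
    have key : ∀ i j : ℕ, i < j → Disjoint
        (Set.Ico (((i + 1 : ℕ) : ℝ) * Δ) (((i + 2 : ℕ) : ℝ) * Δ))
        (Set.Ico (((j + 1 : ℕ) : ℝ) * Δ) (((j + 2 : ℕ) : ℝ) * Δ)) := by
      intro i j hij
      refine Set.disjoint_left.2 fun y hi hj => ?_
      have : ((i + 2 : ℕ) : ℝ) * Δ ≤ ((j + 1 : ℕ) : ℝ) * Δ :=
        mul_le_mul_of_nonneg_right (by exact_mod_cast (by omega : i + 2 ≤ j + 1)) hΔ.le
      linarith [hi.2, hj.1]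
    intro i _ j _ hij
    rcases lt_or_gt_of_ne hij with h | h
    · exact key i j h
    · exact (key j i h).symm
  have hvol : volume.real (⋃ i ∈ S,
      Set.Ico (((i + 1 : ℕ) : ℝ) * Δ) (((i + 2 : ℕ) : ℝ) * Δ)) = S.card * Δ := by
    rw [measureReal_biUnion_finset hdisj (fun _ _ => measurableSet_Ico) (by simp)]
    rw [Finset.sum_congr rfl (g := fun _ => Δ)]
    · simp
    · intro i _
      rw [Real.volume_real_Ico_of_le (by gcongr; omega)]
      push_cast
      ring
  have hb := D.volume_le_of_cover hΔ hfreq hdur (t := ((k + 1 : ℕ) : ℝ) * Δ) hΔ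
    (by push_cast; nlinarith [mul_nonneg (Nat.cast_nonneg (α := ℝ) k) hΔ.le])
    (X := ⋃ i ∈ S, Set.Ico (((i + 1 : ℕ) : ℝ) * Δ) (((i + 2 : ℕ) : ℝ) * Δ)) (by
      refine Set.iUnion₂_subset fun i hi y hy => ?_
      have hik : i + 2 ≤ k + 1 := by
        have := (Finset.mem_filter.1 hi).1
        rw [Finset.mem_range] at this
        omega
      have h2 : ((i + 2 : ℕ) : ℝ) * Δ ≤ ((k + 1 : ℕ) : ℝ) * Δ := by gcongr
      have h1 : Δ ≤ ((i + 1 : ℕ) : ℝ) * Δ := by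
        push_cast
        nlinarith [mul_nonneg (Nat.cast_nonneg (α := ℝ) i) hΔ.le]
      exact ⟨h1.trans hy.1, hy.2.le.trans h2⟩) (by
      intro y hy
      obtain ⟨i, hi, hy⟩ := Set.mem_iUnion₂.1 hy
      obtain ⟨q, hq, h1, h2⟩ := D.exists_interval_of_fails (Finset.mem_filter.1 hi).2
      refine ⟨q, hq, D.period_le_start hq, h1.trans hy.1, ?_⟩
      have := hy.2
      have e : ((i + 2 : ℕ) : ℝ) * Δ = ((i + 1 : ℕ) : ℝ) * Δ + Δ := by push_cast; ring
      linarith)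
  rw [hvol] at hb
  rw [hcount, ← mul_le_mul_iff_left₀ hΔ]
  refine hb.trans (le_of_eq ?_)
  have : Δ ≠ 0 := hΔ.ne'
  field_simp
  push_cast
  ring

end DoS

section Theta

variable {Δ : ℝ} (D : DoS Δ) {γ₁ γ₂ θ₀ : ℝ}

theorem theta_succ_of_fails {k : ℕ} (h : D.Fails (k + 1)) :
    theta D γ₁ γ₂ θ₀ (k + 1) = γ₂ * theta D γ₁ γ₂ θ₀ k := by simp [theta, h]

theorem theta_succ_of_not_fails {k : ℕ} (h : ¬ D.Fails (k + 1)) :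
    theta D γ₁ γ₂ θ₀ (k + 1) = γ₁ * theta D γ₁ γ₂ θ₀ k := by simp [theta, h]

theorem theta_pos (hγ₁ : 0 < γ₁) (hγ₂ : 0 < γ₂) (hθ₀ : 0 < θ₀) (k : ℕ) :
    0 < theta D γ₁ γ₂ θ₀ k := by
  induction k with
  | zero => exact hθ₀
  | succ k ih =>
    by_cases h : D.Fails (k + 1)
    · rw [theta_succ_of_fails D h]; positivity
    · rw [theta_succ_of_not_fails D h]; positivity

theorem theta_eq_exp (hγ₁ : 0 < γ₁) (hγ₂ : 0 < γ₂) (k : ℕ) :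
    theta D γ₁ γ₂ θ₀ k = θ₀ * Real.exp (k * Real.log γ₁ +
      D.failCount k * (Real.log γ₂ - Real.log γ₁)) := by
  classical
  induction k with
  | zero => simp [theta, DoS.failCount]
  | succ k ih =>
    by_cases h : D.Fails (k + 1)
    · have hc : D.failCount (k + 1) = D.failCount k + 1 := by
        simp [DoS.failCount, Nat.count_succ, h]
      rw [theta_succ_of_fails D h, ih, hc]
      nth_rw 1 [← Real.exp_log hγ₂]
      rw [mul_left_comm, ← Real.exp_add]
      congr 2
      push_cast
      ring
    · have hc : D.failCount (k + 1) = D.failCount k := by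
        simp [DoS.failCount, Nat.count_succ, h]
      rw [theta_succ_of_not_fails D h, ih, hc]
      nth_rw 1 [← Real.exp_log hγ₁]
      rw [mul_left_comm, ← Real.exp_add]
      congr 2
      push_cast
      ring

theorem tendsto_theta {η τD κ T : ℝ} (hΔ : 0 < Δ) (hτD : 0 < τD) (hT : 1 < T)
    (hfreq : D.FrequencyBound η τD) (hdur : D.DurationBound κ T) (hγ₁ : 0 < γ₁) (hγ₁' : γ₁ < 1)
    (hγ₂ : 0 < γ₂) (hθ₀ : 0 < θ₀)
    (hrate : 1 / T + Δ / τD < -Real.log γ₁ / (Real.log γ₂ - Real.log γ₁)) :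
    Filter.Tendsto (theta D γ₁ γ₂ θ₀) Filter.atTop (𝓝 0) := by
  have hlog : Real.log γ₁ < 0 := Real.log_neg hγ₁ hγ₁'
  have hμ : 0 < 1 / T + Δ / τD := by positivity
  set μ := 1 / T + Δ / τD with hμdef
  set ℓ := Real.log γ₂ - Real.log γ₁ with hℓdef
  -- If `ℓ ≤ 0`, the right side of `hrate` would be nonpositive (at `ℓ = 0` because division by zero
  -- gives zero).
  have hℓ : 0 < ℓ := by
    by_contra h
    exact absurd (hμ.trans hrate) (not_lt.2 (div_nonpos_of_nonneg_of_nonpos (by linarith)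
      (not_lt.1 h)))
  have hneg : Real.log γ₁ + μ * ℓ < 0 := by
    have := (lt_div_iff₀ hℓ).1 hrate
    linarith
  set c := (κ + Δ * η) / Δ * ℓ with hc
  have hle : ∀ k : ℕ, theta D γ₁ γ₂ θ₀ k ≤
      θ₀ * Real.exp (c + k * (Real.log γ₁ + μ * ℓ)) := by
    intro k
    rw [theta_eq_exp D hγ₁ hγ₂]
    refine mul_le_mul_of_nonneg_left (Real.exp_le_exp.2 ?_) hθ₀.le
    have := mul_le_mul_of_nonneg_right (D.failCount_le hΔ hfreq hdur k) hℓ.le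
    rw [← hμdef] at this
    rw [hc]
    linarith
  have hlim : Filter.Tendsto (fun k : ℕ => θ₀ * Real.exp (c + k * (Real.log γ₁ + μ * ℓ)))
      Filter.atTop (𝓝 0) := by
    rw [← mul_zero θ₀]
    refine Filter.Tendsto.const_mul _ (Real.tendsto_exp_atBot.comp ?_)
    exact Filter.tendsto_atBot_add_const_left _ _
      (tendsto_natCast_atTop_atTop.atTop_mul_const_of_neg hneg)
  exact squeeze_zero (fun k => (theta_pos D hγ₁ hγ₂ hθ₀ k).le) hle hlim

end Theta

/-! ### Euclidean norms of vectors and matrices -/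

section Norms

variable {ι κ l : Type*} [Fintype ι] [Fintype κ] [Fintype l]

/-- The Euclidean norm of a vector. -/
noncomputable def euclNorm (v : ι → ℝ) : ℝ := ‖WithLp.toLp 2 v‖

theorem euclNorm_eq_sqrt (v : ι → ℝ) : euclNorm v = √(∑ i, v i ^ 2) := by
  simp [euclNorm, EuclideanSpace.norm_eq]

theorem sum_sq_eq_euclNorm_sq (v : ι → ℝ) : ∑ i, v i ^ 2 = euclNorm v ^ 2 := by
  rw [euclNorm_eq_sqrt, Real.sq_sqrt (Finset.sum_nonneg fun i _ => sq_nonneg _)]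

theorem euclNorm_nonneg (v : ι → ℝ) : 0 ≤ euclNorm v := norm_nonneg _

theorem euclNorm_add_le (v v' : ι → ℝ) : euclNorm (v + v') ≤ euclNorm v + euclNorm v' := by
  simpa [euclNorm] using norm_add_le (WithLp.toLp 2 v) (WithLp.toLp 2 v')

theorem euclNorm_smul (c : ℝ) (v : ι → ℝ) : euclNorm (c • v) = |c| * euclNorm v := by
  simpa [euclNorm] using norm_smul c (WithLp.toLp 2 v)

theorem norm_le_euclNorm (v : ι → ℝ) : ‖v‖ ≤ euclNorm v :=
  (pi_norm_le_iff_of_nonneg (euclNorm_nonneg v)).2 fun i =>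
    PiLp.norm_apply_le (WithLp.toLp 2 v) i

theorem euclNorm_le_sqrt_card_mul {v : ι → ℝ} {c : ℝ} (hc : 0 ≤ c) (hv : ∀ i, |v i| ≤ c) :
    euclNorm v ≤ √(Fintype.card ι) * c := by
  rw [euclNorm_eq_sqrt]
  refine Real.sqrt_le_iff.2 ⟨by positivity, ?_⟩
  rw [mul_pow, Real.sq_sqrt (by positivity)]
  calc ∑ i, v i ^ 2 ≤ ∑ _i : ι, c ^ 2 :=
        Finset.sum_le_sum fun i _ => sq_le_sq' (abs_le.1 (hv i)).1 (abs_le.1 (hv i)).2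
    _ = _ := by simp

theorem euclNorm_sumElim_le {v : ι → ℝ} {v' : κ → ℝ} {c c' : ℝ} (hv : euclNorm v ≤ c)
    (hv' : euclNorm v' ≤ c') : euclNorm (Sum.elim v v') ≤ √(c ^ 2 + c' ^ 2) := by
  rw [euclNorm_eq_sqrt]
  refine Real.sqrt_le_sqrt ?_
  rw [Fintype.sum_sum_type]
  simp only [Sum.elim_inl, Sum.elim_inr]
  rw [sum_sq_eq_euclNorm_sq, sum_sq_eq_euclNorm_sq]
  gcongr <;> exact euclNorm_nonneg _

section

open scoped Matrix.Norms.L2Operator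

theorem norm2_nonneg [DecidableEq κ] (X : Matrix ι κ ℝ) : 0 ≤ norm2 X := norm_nonneg X

theorem euclNorm_mulVec_le [DecidableEq κ] (X : Matrix ι κ ℝ) (v : κ → ℝ) :
    euclNorm (X *ᵥ v) ≤ norm2 X * euclNorm v :=
  Matrix.l2_opNorm_mulVec X (WithLp.toLp 2 v)

theorem norm2_mul_le [DecidableEq κ] [DecidableEq l] (X : Matrix ι κ ℝ) (Y : Matrix κ l ℝ) :
    norm2 (X * Y) ≤ norm2 X * norm2 Y :=
  Matrix.l2_opNorm_mul X Y

/-- By the C*-identity the norm is idempotent. Equality fails for an empty index type, which occurs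
for the disagreement coordinates when `N = 1`. -/
theorem norm2_one_le [DecidableEq ι] : norm2 (1 : Matrix ι ι ℝ) ≤ 1 := by
  have h : norm2 (1 : Matrix ι ι ℝ) * norm2 (1 : Matrix ι ι ℝ) = norm2 (1 : Matrix ι ι ℝ) := by
    have := Matrix.l2_opNorm_conjTranspose_mul_self (1 : Matrix ι ι ℝ)
    rw [Matrix.conjTranspose_one, Matrix.one_mul] at this
    exact this.symm
  nlinarith [norm2_nonneg (1 : Matrix ι ι ℝ)]

theorem norm2_le_one_of_transpose_mul_self [DecidableEq ι] [DecidableEq κ] {V : Matrix ι κ ℝ}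
    (hV : Vᵀ * V = 1) : norm2 V ≤ 1 ∧ norm2 Vᵀ ≤ 1 := by
  have h : norm2 (Vᵀ * V) = norm2 V * norm2 V := by
    have := Matrix.l2_opNorm_conjTranspose_mul_self V
    rwa [Matrix.conjTranspose_eq_transpose_of_trivial] at this
  have ht : norm2 Vᵀ = norm2 V := by
    have := Matrix.l2_opNorm_conjTranspose V
    rwa [Matrix.conjTranspose_eq_transpose_of_trivial] at this
  have h1 : norm2 V ≤ 1 := by
    rw [hV] at h
    nlinarith [norm2_one_le (ι := κ), norm2_nonneg V]
  exact ⟨h1, ht.trans_le h1⟩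

end

section

open scoped Matrix.Norms.Operator

theorem norm_mulVec_le (X : Matrix ι κ ℝ) (v : κ → ℝ) : ‖X *ᵥ v‖ ≤ normInf X * ‖v‖ :=
  Matrix.linfty_opNorm_mulVec X v

theorem normInf_nonneg (X : Matrix ι κ ℝ) : 0 ≤ normInf X := norm_nonneg X

end

end Norms

/-! ### Switched products of matrices -/

section Switched

variable {ι : Type*} [Fintype ι] [DecidableEq ι]

/-- If the powers of `J 0` decay at rate `d` up to the constant `C` and the other `J m` have norm
at most `d / C`, then arbitrary products of the `J m` decay at rate `d` up to `C`. -/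
theorem norm2_pow_mul_prod_le {J : ℕ → Matrix ι ι ℝ} {M : ℕ} {d C : ℝ} (hd : 0 ≤ d) (hC : 1 ≤ C)
    (h0 : ∀ p : ℕ, norm2 (J 0 ^ p) ≤ C * d ^ p)
    (hJ : ∀ m, 1 ≤ m → m ≤ M → norm2 (J m) ≤ d / C) (u : List ℕ) (hu : ∀ m ∈ u, m ≤ M) (p : ℕ) :
    norm2 (J 0 ^ p * (u.map J).prod) ≤ C * d ^ (p + u.length) := by
  -- The exponent `p` collects the current run of factors `J 0`. Any other factor ends the run, and
  -- its `1 / C` cancels the constant paid for that run.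
  induction u generalizing p with
  | nil => simpa using h0 p
  | cons m u ih =>
    have ih' := ih fun i hi => hu i (List.mem_cons_of_mem _ hi)
    rw [List.map_cons, List.prod_cons, List.length_cons]
    rcases Nat.eq_zero_or_pos m with rfl | hm
    · rw [← mul_assoc, ← pow_succ]
      refine (ih' (p + 1)).trans (le_of_eq ?_)
      ring
    · have h1 := ih' 0
      rw [pow_zero, one_mul, zero_add] at h1
      calc norm2 (J 0 ^ p * (J m * (u.map J).prod))
          ≤ norm2 (J 0 ^ p) * (norm2 (J m) * norm2 (u.map J).prod) :=
            (norm2_mul_le _ _).trans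
              (mul_le_mul_of_nonneg_left (norm2_mul_le _ _) (norm2_nonneg _))
        _ ≤ C * d ^ p * (d / C * (C * d ^ u.length)) := by
            gcongr
            · exact mul_nonneg (norm2_nonneg _) (norm2_nonneg _)
            · exact h0 p
            · exact norm2_nonneg _
            · exact hJ m hm (hu m (by simp))
        _ = C * d ^ (p + (u.length + 1)) := by
            field_simp
            ring

/-- Every product of `r` of the matrices `J 0, …, J M` maps `v` to a vector of Euclidean norm at
most `c * d ^ r`. -/
def DecaysFrom (J : ℕ → Matrix ι ι ℝ) (M : ℕ) (d c : ℝ) (v : ι → ℝ) : Prop :=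
  ∀ u : List ℕ, (∀ m ∈ u, m ≤ M) → euclNorm ((u.map J).prod *ᵥ v) ≤ c * d ^ u.length

namespace DecaysFrom

variable {J : ℕ → Matrix ι ι ℝ} {M : ℕ} {d c c' : ℝ} {v v' : ι → ℝ}

theorem euclNorm_le (h : DecaysFrom J M d c v) : euclNorm v ≤ c := by
  simpa using h [] (by simp)

theorem mono (hd : 0 ≤ d) (h : DecaysFrom J M d c v) (hc : c ≤ c') : DecaysFrom J M d c' v :=
  fun u hu => (h u hu).trans (by gcongr)

theorem add (h : DecaysFrom J M d c v) (h' : DecaysFrom J M d c' v') :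
    DecaysFrom J M d (c + c') (v + v') := fun u hu => by
  rw [Matrix.mulVec_add, add_mul]
  exact (euclNorm_add_le _ _).trans (add_le_add (h u hu) (h' u hu))

theorem smul {b : ℝ} (hb : 0 ≤ b) (h : DecaysFrom J M d c v) :
    DecaysFrom J M d (b * c) (b • v) := fun u hu => by
  rw [Matrix.mulVec_smul, euclNorm_smul, abs_of_nonneg hb, mul_assoc]
  exact mul_le_mul_of_nonneg_left (h u hu) hb

/-- Quantifying over all products makes this mere appending of one factor, so no constant
accumulates from step to step. -/
theorem mulVec (h : DecaysFrom J M d c v) {m : ℕ} (hm : m ≤ M) :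
    DecaysFrom J M d (d * c) (J m *ᵥ v) := fun u hu => by
  have := h (u ++ [m]) (by simpa [or_imp, forall_and] using ⟨hu, hm⟩)
  simp only [List.map_append, List.prod_append, List.map_cons, List.map_nil, List.prod_cons,
    List.prod_nil, mul_one, List.length_append, List.length_cons, List.length_nil] at this
  rw [Matrix.mulVec_mulVec]
  refine this.trans (le_of_eq ?_)
  ring

theorem of_euclNorm_le {C : ℝ} (hd : 0 ≤ d) (hC : 1 ≤ C) (h0 : ∀ p : ℕ, norm2 (J 0 ^ p) ≤ C * d ^ p)
    (hJ : ∀ m, 1 ≤ m → m ≤ M → norm2 (J m) ≤ d / C) (hv : euclNorm v ≤ c) :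
    DecaysFrom J M d (C * c) v := fun u hu => by
  have h := norm2_pow_mul_prod_le hd hC h0 hJ u hu 0
  rw [pow_zero, one_mul, zero_add] at h
  calc euclNorm ((u.map J).prod *ᵥ v) ≤ norm2 (u.map J).prod * euclNorm v :=
        euclNorm_mulVec_le _ _
    _ ≤ C * d ^ u.length * c := by
        gcongr
        exact euclNorm_nonneg v
    _ = C * c * d ^ u.length := by ring

end DecaysFrom

end Switched

/-! ### The quantization error -/

theorem abs_sub_quantPos_le {R : ℕ} {σ χ : ℝ} (hσ : 0 < σ) (hχ : -σ ≤ χ)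
    (hχ' : χ ≤ (2 * R + 1) * σ) : |χ - quantPos R σ χ| ≤ σ := by
  unfold quantPos
  split_ifs with h1 h2
  · rw [sub_zero, abs_le]
    exact ⟨hχ, h1.le⟩
  · have hz := Int.floor_le ((χ / σ + 1) / 2)
    have hz' := Int.lt_floor_add_one ((χ / σ + 1) / 2)
    set z : ℝ := (⌊(χ / σ + 1) / 2⌋ : ℝ)
    obtain ⟨y, rfl⟩ : ∃ y, χ = y * σ := ⟨χ / σ, by field_simp⟩
    rw [mul_div_cancel_right₀ _ hσ.ne'] at hz hz'
    rw [abs_le]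
    constructor <;> nlinarith
  -- In the saturated branch the range bound forces `χ = (2R+1)σ`, where the error is exactly `σ`.
  · rw [abs_le]
    constructor <;> nlinarith

theorem abs_sub_quant_le {R : ℕ} {σ χ : ℝ} (hσ : 0 < σ) (hχ : |χ| ≤ (2 * R + 1) * σ) :
    |χ - quant R σ χ| ≤ σ := by
  obtain ⟨h1, h2⟩ := abs_le.1 hχ
  unfold quant
  split_ifs with h
  · have := abs_sub_quantPos_le (R := R) hσ (χ := -χ) (by linarith) (by linarith)
    rwa [← abs_neg, show -(χ - -quantPos R σ (-χ)) = -χ - quantPos R σ (-χ) by ring]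
  · exact abs_sub_quantPos_le hσ (not_le.1 h).le h2

/-! ### Stacked vectors of the network -/

section Stack

variable {N n w : ℕ}

/-- The stacked vector of the vectors of the agents. -/
def stack (x : Fin N → Fin n → ℝ) : Fin N × Fin n → ℝ := fun p => x p.1 p.2

/-- The deviations of the states from their average. -/
noncomputable def deviation (x : Fin N → Fin n → ℝ) : Fin N → Fin n → ℝ :=
  fun i => x i - average x

theorem kronecker_mulVec_stack (X : Matrix (Fin N) (Fin N) ℝ) (Y : Matrix (Fin n) (Fin n) ℝ)
    (x : Fin N → Fin n → ℝ) :
    (X ⊗ₖ Y) *ᵥ stack x = stack fun i => ∑ j, X i j • (Y *ᵥ x j) := by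
  ext ⟨i, c⟩
  simp only [Matrix.mulVec, dotProduct, stack, Matrix.kroneckerMap_apply, Finset.sum_apply,
    Pi.smul_apply, smul_eq_mul, Fintype.sum_prod_type, Finset.mul_sum, mul_assoc]

theorem one_kronecker_mulVec_stack (A : Matrix (Fin n) (Fin n) ℝ) (x : Fin N → Fin n → ℝ) :
    ((1 : Matrix (Fin N) (Fin N) ℝ) ⊗ₖ A) *ᵥ stack x = stack fun i => A *ᵥ x i := by
  rw [kronecker_mulVec_stack]
  simp [Matrix.one_apply]

theorem euclNorm_stack_le {x : Fin N → Fin n → ℝ} {c : ℝ} (hc : 0 ≤ c) (hx : ∀ i, ‖x i‖ ≤ c) :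
    euclNorm (stack x) ≤ √((N : ℝ) * n) * c := by
  have := euclNorm_le_sqrt_card_mul (v := stack x) hc
    fun p => (norm_le_pi_norm (x p.1) p.2).trans (hx p.1)
  simpa using this

theorem norm_le_euclNorm_stack (x : Fin N → Fin n → ℝ) (i : Fin N) :
    ‖x i‖ ≤ euclNorm (stack x) :=
  (pi_norm_le_iff_of_nonneg (euclNorm_nonneg _)).2 fun c =>
    (norm_le_pi_norm (stack x) (i, c)).trans (norm_le_euclNorm _)

variable {𝒢 : SimpleGraph (Fin N)} {a : Matrix (Fin N) (Fin N) ℝ}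
  (A : Matrix (Fin n) (Fin n) ℝ) (B : Matrix (Fin n) (Fin w) ℝ) (K : Matrix (Fin w) (Fin n) ℝ)

theorem IsAdjacency.sum_laplacian_smul {E : Type*} [AddCommGroup E] [Module ℝ E]
    (ha : IsAdjacency 𝒢 a) (y : Fin N → E) (i : Fin N) :
    ∑ j, laplacian a i j • y j = -∑ j, a i j • (y j - y i) := by
  have hii : a i i = 0 := ha.zero i i (𝒢.loopless.irrefl i)
  have h : ∀ j, laplacian a i j • y j =
      (if i = j then (∑ l, a i l) • y j else 0) - a i j • y j := by
    intro j
    by_cases hij : i = j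
    · subst hij
      simp [laplacian, hii]
    · simp [laplacian, hij]
  simp only [h, Finset.sum_sub_distrib, smul_sub, Finset.sum_smul]
  simp

theorem matL_mulVec_stack (ha : IsAdjacency 𝒢 a) (y : Fin N → Fin n → ℝ) :
    matL a B K *ᵥ stack y = -stack fun i => B *ᵥ control a K y i := by
  rw [matL, kronecker_mulVec_stack]
  ext ⟨i, c⟩
  simp only [stack, Pi.neg_apply]
  rw [ha.sum_laplacian_smul (fun j => (B * K) *ᵥ y j) i]
  simp only [control, Matrix.mulVec_mulVec, Matrix.mulVec_sum, Matrix.mulVec_smul,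
    Matrix.mulVec_sub, Pi.neg_apply]

theorem matL_mulVec_stack_const (ha : IsAdjacency 𝒢 a) (v : Fin n → ℝ) :
    matL a B K *ᵥ stack (fun _ => v) = 0 := by
  rw [matL_mulVec_stack B K ha]
  ext
  simp [control, stack]

theorem matL_mulVec_stack_deviation (ha : IsAdjacency 𝒢 a) (x : Fin N → Fin n → ℝ) :
    matL a B K *ᵥ stack (deviation x) = matL a B K *ᵥ stack x := by
  have h : stack (deviation x) = stack x - stack (fun _ => average x) := rfl
  rw [h, Matrix.mulVec_sub, matL_mulVec_stack_const B K ha, sub_zero]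

theorem IsAdjacency.sum_control (ha : IsAdjacency 𝒢 a) (y : Fin N → Fin n → ℝ) :
    ∑ i, control a K y i = 0 := by
  simp only [control]
  rw [← Matrix.mulVec_sum]
  -- Swapping the two indices flips the sign, by symmetry of `a`.
  have h : ∑ i, ∑ j, a i j • (y j - y i) = -∑ i, ∑ j, a i j • (y j - y i) := by
    conv_lhs => rw [Finset.sum_comm]
    rw [← Finset.sum_neg_distrib]
    refine Finset.sum_congr rfl fun i _ => ?_
    rw [← Finset.sum_neg_distrib]
    refine Finset.sum_congr rfl fun j _ => ?_
    rw [ha.symm j i, ← smul_neg, neg_sub]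
  rw [self_eq_neg.1 h, Matrix.mulVec_zero]

theorem average_step (ha : IsAdjacency 𝒢 a) (x y : Fin N → Fin n → ℝ) :
    average (fun i => A *ᵥ x i + B *ᵥ control a K y i) = A *ᵥ average x := by
  simp only [average, Finset.sum_add_distrib]
  rw [← Matrix.mulVec_sum, ← Matrix.mulVec_sum, ha.sum_control, Matrix.mulVec_zero, add_zero,
    Matrix.mulVec_smul]

/-- The controls sum to zero, so the average evolves by `A` alone. Writing `y = x - (x - y)` splits
the feedback, and the Laplacian sees only the deviation of `x`. -/
theorem stack_deviation_step (ha : IsAdjacency 𝒢 a) (x y : Fin N → Fin n → ℝ) :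
    stack (deviation fun i => A *ᵥ x i + B *ᵥ control a K y i) =
      matG a A B K *ᵥ stack (deviation x) + matL a B K *ᵥ stack (x - y) := by
  have h1 : stack (x - y) = stack x - stack y := rfl
  rw [matG, ← matL, Matrix.sub_mulVec, one_kronecker_mulVec_stack,
    matL_mulVec_stack_deviation B K ha, h1, Matrix.mulVec_sub, matL_mulVec_stack B K ha y]
  ext ⟨i, c⟩
  have h2 := congrFun (average_step A B K ha x y) c
  simp only [stack, deviation, Matrix.mulVec_sub, Pi.sub_apply, Pi.add_apply, Pi.neg_apply, h2]
  ring

theorem stack_error_step (ha : IsAdjacency 𝒢 a) (x y : Fin N → Fin n → ℝ) :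
    stack (fun i => A *ᵥ x i + B *ᵥ control a K y i - A *ᵥ y i) =
      (-matL a B K) *ᵥ stack (deviation x) + matH a A B K *ᵥ stack (x - y) := by
  have h1 : stack (x - y) = stack x - stack y := rfl
  rw [matH, ← matL, Matrix.add_mulVec, one_kronecker_mulVec_stack, Matrix.neg_mulVec,
    matL_mulVec_stack_deviation B K ha, h1, Matrix.mulVec_sub, matL_mulVec_stack B K ha y]
  ext ⟨i, c⟩
  simp only [stack, Matrix.mulVec_sub, Pi.sub_apply, Pi.add_apply, Pi.neg_apply]
  ring

end Stack

/-! ### The disagreement coordinates -/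

section Disagreement

variable {N n : ℕ} [NeZero N] {a U : Matrix (Fin N) (Fin N) ℝ}

/-- The columns of `U ⊗ I` other than the first `n` ones. -/
def disagreementBasis (n : ℕ) (U : Matrix (Fin N) (Fin N) ℝ) :
    Matrix (Fin N × Fin n) ({i : Fin N // i ≠ 0} × Fin n) ℝ :=
  (U ⊗ₖ (1 : Matrix (Fin n) (Fin n) ℝ)).submatrix id fun p => (p.1.1, p.2)

theorem disagreementBasis_transpose_mul_self (hU : Uᵀ * U = 1) :
    (disagreementBasis n U)ᵀ * disagreementBasis n U = 1 := by
  have hinj : Function.Injective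
      (fun p : {i : Fin N // i ≠ 0} × Fin n => ((p.1.1, p.2) : Fin N × Fin n)) := by
    rintro ⟨⟨i, hi⟩, c⟩ ⟨⟨j, hj⟩, c'⟩ h
    simpa using h
  rw [disagreementBasis, Matrix.transpose_submatrix,
    ← Matrix.submatrix_mul _ _ _ id _ Function.bijective_id, ← Matrix.kroneckerMap_transpose,
    ← Matrix.mul_kronecker_mul, hU]
  simp [Matrix.submatrix_one _ hinj]

/-- Since `U * Uᵀ = 1`, dropping the constant first column removes exactly the averaging matrix with
entries `1 / N`. -/
theorem disagreementBasis_mul_transpose_mulVec (hU : IsEigenbasis a U) (x : Fin N → Fin n → ℝ) :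
    (disagreementBasis n U * (disagreementBasis n U)ᵀ) *ᵥ stack x = stack (deviation x) := by
  have hUU : U * Uᵀ = 1 := mul_eq_one_comm.1 hU.orthogonal
  have hN : (N : ℝ) ≠ 0 := Nat.cast_ne_zero.2 (NeZero.ne N)
  have hsum : ∀ i j : Fin N, ∑ k : {k : Fin N // k ≠ 0}, U i k * U j k =
      (1 : Matrix (Fin N) (Fin N) ℝ) i j - (N : ℝ)⁻¹ := by
    intro i j
    have h := Fintype.sum_subtype_add_sum_subtype (fun k : Fin N => k ≠ 0) (fun k => U i k * U j k)
    have h0 : ∑ k : {k : Fin N // ¬ k ≠ 0}, U i k * U j k = U i 0 * U j 0 := by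
      have : ∀ k : {k : Fin N // ¬ k ≠ 0}, (k : Fin N) = 0 := fun k => not_not.1 k.2
      have hu : Unique {k : Fin N // ¬ k ≠ 0} :=
        ⟨⟨⟨0, by simp⟩⟩, fun k => Subtype.ext (this k)⟩
      rw [Fintype.sum_unique, this]
    have h1 : ∑ k, U i k * U j k = (1 : Matrix (Fin N) (Fin N) ℝ) i j := by
      rw [← hUU]
      rfl
    have h2 : U i 0 * U j 0 = (N : ℝ)⁻¹ := by
      rw [hU.first, hU.first, div_mul_div_comm, Real.mul_self_sqrt (by positivity)]
      simp
    linarith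
  have hV : disagreementBasis n U * (disagreementBasis n U)ᵀ =
      (1 - Matrix.of fun _ _ => (N : ℝ)⁻¹ : Matrix (Fin N) (Fin N) ℝ) ⊗ₖ
        (1 : Matrix (Fin n) (Fin n) ℝ) := by
    ext ⟨i, c⟩ ⟨j, c'⟩
    simp only [Matrix.mul_apply, disagreementBasis, Matrix.submatrix_apply, id,
      Matrix.kroneckerMap_apply, Matrix.transpose_apply, Fintype.sum_prod_type, Matrix.sub_apply,
      Matrix.of_apply, ← hsum, Finset.sum_mul]
    refine Finset.sum_congr rfl fun k _ => ?_
    by_cases hc : c = c' <;> simp [Matrix.one_apply, hc]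
  rw [hV, kronecker_mulVec_stack]
  ext ⟨i, c⟩
  simp [stack, deviation, average, Matrix.one_apply, sub_mul, Finset.mul_sum]

variable {w : ℕ} (A : Matrix (Fin n) (Fin n) ℝ) (B : Matrix (Fin n) (Fin w) ℝ)
  (K : Matrix (Fin w) (Fin n) ℝ)

theorem matJsucc_eq (γ₂ : ℝ) (m : ℕ) :
    matJsucc a A B K U γ₂ m =
      (disagreementBasis n U)ᵀ * matGsucc a A B K γ₂ m * disagreementBasis n U := by
  ext p q
  simp [matJsucc, disagreementBasis, Matrix.mul_apply]

/-- The disagreement coordinates at a successful transmission after `m` failed ones. -/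
theorem disagreement_step (hU : IsEigenbasis a U) {γ₂ : ℝ} (hγ₂ : γ₂ ≠ 0) (m : ℕ)
    (x : Fin N → Fin n → ℝ) (e : Fin N × Fin n → ℝ) :
    (disagreementBasis n U)ᵀ *ᵥ (Matrix.fromCols (matG a A B K) (matL a B K) *ᵥ
      (matAbar a A B K ^ m *ᵥ Sum.elim (stack (deviation x)) e)) =
    γ₂ ^ m • (matJsucc a A B K U γ₂ m *ᵥ ((disagreementBasis n U)ᵀ *ᵥ stack (deviation x)) +
      (disagreementBasis n U)ᵀ *ᵥ (matLsucc a A B K γ₂ m *ᵥ e)) := by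
  have hp : disagreementBasis n U *ᵥ ((disagreementBasis n U)ᵀ *ᵥ stack (deviation x)) =
      stack (deviation x) := by
    have hT := disagreementBasis_transpose_mul_self (n := n) hU.orthogonal
    rw [← disagreementBasis_mul_transpose_mulVec hU x, Matrix.mulVec_mulVec, Matrix.mulVec_mulVec,
      ← Matrix.mul_assoc, Matrix.mul_assoc _ _ (disagreementBasis n U), hT, Matrix.mul_one]
  have hGs : γ₂ ^ m • matGsucc a A B K γ₂ m = matG a A B K * (matAbar a A B K ^ m).toBlocks₁₁ +
      matL a B K * (matAbar a A B K ^ m).toBlocks₂₁ := by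
    rw [matGsucc, smul_smul, mul_inv_cancel₀ (pow_ne_zero _ hγ₂), one_smul]
  have hLs : γ₂ ^ m • matLsucc a A B K γ₂ m = matG a A B K * (matAbar a A B K ^ m).toBlocks₁₂ +
      matL a B K * (matAbar a A B K ^ m).toBlocks₂₂ := by
    rw [matLsucc, smul_smul, mul_inv_cancel₀ (pow_ne_zero _ hγ₂), one_smul]
  have hblock : Matrix.fromCols (matG a A B K) (matL a B K) * matAbar a A B K ^ m =
      Matrix.fromCols (γ₂ ^ m • matGsucc a A B K γ₂ m) (γ₂ ^ m • matLsucc a A B K γ₂ m) := by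
    rw [hGs, hLs]
    conv_lhs => rw [← Matrix.fromBlocks_toBlocks (matAbar a A B K ^ m)]
    rw [Matrix.fromCols_mul_fromBlocks]
  rw [Matrix.mulVec_mulVec _ _ (matAbar a A B K ^ m), hblock, Matrix.fromCols_mulVec_sumElim,
    matJsucc_eq, ← Matrix.mulVec_mulVec, ← Matrix.mulVec_mulVec, hp, Matrix.smul_mulVec,
    Matrix.smul_mulVec, ← smul_add, Matrix.mulVec_smul, Matrix.mulVec_add]

end Disagreement

/-! ### Bounds on the closed loop -/

section Bounds

variable {N n w : ℕ} (a : Matrix (Fin N) (Fin N) ℝ) (A : Matrix (Fin n) (Fin n) ℝ)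
  (B : Matrix (Fin n) (Fin w) ℝ) (K : Matrix (Fin w) (Fin n) ℝ)

theorem constZeta_nonneg (γ₂ : ℝ) (M : ℕ) : 0 ≤ constZeta a A B K γ₂ M :=
  (norm2_nonneg ((γ₂⁻¹ • matAbar a A B K) ^ 0)).trans
    (Finset.le_sup' (fun m => norm2 ((γ₂⁻¹ • matAbar a A B K) ^ m)) (by simp))

theorem constC0_nonneg (γ₂ : ℝ) (M : ℕ) : 0 ≤ constC0 a A B K γ₂ M :=
  (norm2_nonneg (matLsucc a A B K γ₂ 0)).trans
    (Finset.le_sup' (fun m => norm2 (matLsucc a A B K γ₂ m)) (by simp))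

theorem norm2_matLsucc_le (γ₂ : ℝ) {m M : ℕ} (hm : m ≤ M) :
    norm2 (matLsucc a A B K γ₂ m) ≤ constC0 a A B K γ₂ M :=
  Finset.le_sup' (fun m => norm2 (matLsucc a A B K γ₂ m)) (by simpa [Nat.lt_succ_iff] using hm)

theorem euclNorm_matAbar_pow_mulVec_le {γ₂ : ℝ} (hγ₂ : 0 < γ₂) {m M : ℕ} (hm : m ≤ M)
    (z : (Fin N × Fin n) ⊕ (Fin N × Fin n) → ℝ) :
    euclNorm (matAbar a A B K ^ m *ᵥ z) ≤ constZeta a A B K γ₂ M * γ₂ ^ m * euclNorm z := by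
  have h : matAbar a A B K ^ m = γ₂ ^ m • (γ₂⁻¹ • matAbar a A B K) ^ m := by
    rw [smul_pow, smul_smul, ← mul_pow, mul_inv_cancel₀ hγ₂.ne', one_pow, one_smul]
  have hζ : norm2 ((γ₂⁻¹ • matAbar a A B K) ^ m) ≤ constZeta a A B K γ₂ M :=
    Finset.le_sup' (fun m => norm2 ((γ₂⁻¹ • matAbar a A B K) ^ m))
      (by simpa [Nat.lt_succ_iff] using hm)
  rw [h, Matrix.smul_mulVec, euclNorm_smul, abs_of_pos (pow_pos hγ₂ m)]
  calc γ₂ ^ m * euclNorm ((γ₂⁻¹ • matAbar a A B K) ^ m *ᵥ z)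
      ≤ γ₂ ^ m * (constZeta a A B K γ₂ M * euclNorm z) := by
        gcongr
        exact (euclNorm_mulVec_le _ _).trans
          (mul_le_mul_of_nonneg_right hζ (euclNorm_nonneg _))
    _ = _ := by ring

variable {a}

/-- The vector to be quantized is the block row `[-L H]` applied to `z`, which is how that row
enters the condition on `R`. -/
theorem norm_error_step_le {𝒢 : SimpleGraph (Fin N)} (ha : IsAdjacency 𝒢 a)
    (x y : Fin N → Fin n → ℝ) (i : Fin N) :
    ‖A *ᵥ x i + B *ᵥ control a K y i - A *ᵥ y i‖ ≤
      normInf (Matrix.fromCols (-matL a B K) (matH a A B K)) *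
        euclNorm (Sum.elim (stack (deviation x)) (stack (x - y))) := by
  have h := stack_error_step A B K ha x y
  rw [← Matrix.fromCols_mulVec_sumElim] at h
  calc ‖A *ᵥ x i + B *ᵥ control a K y i - A *ᵥ y i‖
      ≤ ‖stack fun i => A *ᵥ x i + B *ᵥ control a K y i - A *ᵥ y i‖ :=
        (pi_norm_le_iff_of_nonneg (norm_nonneg _)).2 fun c => norm_le_pi_norm
          (stack fun i => A *ᵥ x i + B *ᵥ control a K y i - A *ᵥ y i) (i, c)
    _ ≤ _ := by
        rw [h]
        exact (norm_mulVec_le _ _).trans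
          (mul_le_mul_of_nonneg_left (norm_le_euclNorm _) (normInf_nonneg _))

theorem sumElim_step {𝒢 : SimpleGraph (Fin N)} (ha : IsAdjacency 𝒢 a)
    (x y : Fin N → Fin n → ℝ) :
    Sum.elim (stack (deviation fun i => A *ᵥ x i + B *ᵥ control a K y i))
      (stack fun i => A *ᵥ x i + B *ᵥ control a K y i - A *ᵥ y i) =
    matAbar a A B K *ᵥ Sum.elim (stack (deviation x)) (stack (x - y)) := by
  rw [matAbar, Matrix.fromBlocks_mulVec, stack_deviation_step A B K ha,
    stack_error_step A B K ha]
  rfl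

theorem norm_sub_smul_quantVec_le {R : ℕ} {σ θ : ℝ} (hσ : 0 < σ) (hθ : 0 < θ) {v : Fin n → ℝ}
    (hv : ‖θ⁻¹ • v‖ ≤ (2 * R + 1) * σ) : ‖v - θ • quantVec R σ (θ⁻¹ • v)‖ ≤ σ * θ := by
  refine (pi_norm_le_iff_of_nonneg (by positivity)).2 fun c => ?_
  have h := abs_sub_quant_le (R := R) hσ ((norm_le_pi_norm (θ⁻¹ • v) c).trans hv)
  have e : (v - θ • quantVec R σ (θ⁻¹ • v)) c =
      θ * ((θ⁻¹ • v) c - quant R σ ((θ⁻¹ • v) c)) := by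
    simp only [quantVec, Pi.sub_apply, Pi.smul_apply, smul_eq_mul]
    field_simp
  rw [e, Real.norm_eq_abs, abs_mul, abs_of_pos hθ, mul_comm]
  gcongr

end Bounds

section ClosedLoop

variable {Δ : ℝ} {N n w : ℕ} {D : DoS Δ} {a : Matrix (Fin N) (Fin N) ℝ}
  {A : Matrix (Fin n) (Fin n) ℝ} {B : Matrix (Fin n) (Fin w) ℝ} {K : Matrix (Fin w) (Fin n) ℝ}
  {R : ℕ} {σ γ₁ γ₂ θ₀ : ℝ} {x₀ : Fin N → Fin n → ℝ}

theorem closedLoop_snd_succ_of_fails {k : ℕ} (h : D.Fails (k + 1)) :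
    (closedLoop D a A B K R σ γ₁ γ₂ θ₀ x₀ (k + 1)).2 = fun j =>
      A *ᵥ (closedLoop D a A B K R σ γ₁ γ₂ θ₀ x₀ k).2 j := by
  simp [closedLoop, h]

theorem closedLoop_snd_succ_of_not_fails {k : ℕ} (h : ¬ D.Fails (k + 1)) :
    (closedLoop D a A B K R σ γ₁ γ₂ θ₀ x₀ (k + 1)).2 = fun j =>
      A *ᵥ (closedLoop D a A B K R σ γ₁ γ₂ θ₀ x₀ k).2 j + theta D γ₁ γ₂ θ₀ k •
        quantVec R σ ((theta D γ₁ γ₂ θ₀ k)⁻¹ •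
          ((closedLoop D a A B K R σ γ₁ γ₂ θ₀ x₀ (k + 1)).1 j -
            A *ᵥ (closedLoop D a A B K R σ γ₁ γ₂ θ₀ x₀ k).2 j)) := by
  simp [closedLoop, h]

end ClosedLoop

end QuantizedConsensus

/-! ### The induction over transmission attempts -/

open QuantizedConsensus in
theorem theorem1 {N n w : ℕ} [NeZero N]
    -- the network, the agents and the feedback gain
    (𝒢 : SimpleGraph (Fin N)) (h𝒢 : 𝒢.Connected)
    (a : Matrix (Fin N) (Fin N) ℝ) (ha : QuantizedConsensus.IsAdjacency 𝒢 a)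
    (U : Matrix (Fin N) (Fin N) ℝ) (hU : QuantizedConsensus.IsEigenbasis a U)
    (A : Matrix (Fin n) (Fin n) ℝ) (B : Matrix (Fin n) (Fin w) ℝ) (K : Matrix (Fin w) (Fin n) ℝ)
    -- the DoS signal
    (Δ : ℝ) (hΔ : 0 < Δ) (D : QuantizedConsensus.DoS Δ)
    (η τD κ T : ℝ) (hη : 0 ≤ η) (hτD : 0 < τD) (hκ : 0 ≤ κ) (hT : 1 < T)
    (hfreq : D.FrequencyBound η τD) (hdur : D.DurationBound κ T)
    (hDoS : 1 / T + Δ / τD < 1)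
    (M : ℕ) (hM : M = QuantizedConsensus.maxFail Δ η τD κ T)
    -- the initial states, the quantizer and the scaling parameters
    (Cx₀ : ℝ) (hCx₀ : 0 < Cx₀) (x₀ : Fin N → Fin n → ℝ) (hx₀ : ∀ i, ‖x₀ i‖ ≤ Cx₀)
    (R : ℕ) (hR : 0 < R) (σ : ℝ) (hσ : 0 < σ)
    (γ₁ γ₂ θ₀ d₀ C₂ : ℝ) (hγ₂ : 0 < γ₂)
    (hd₀ : QuantizedConsensus.specRadius (QuantizedConsensus.matJsucc a A B K U γ₂ 0) < d₀)
    (hd₀' : d₀ < 1) (hC₂ : 1 ≤ C₂)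
    (hpow : ∀ p : ℕ, 1 ≤ p → QuantizedConsensus.norm2
      (QuantizedConsensus.matJsucc a A B K U γ₂ 0 ^ p) ≤ C₂ * d₀ ^ p)
    (hγ₁ : d₀ < γ₁) (hγ₁' : γ₁ < 1)
    (hJ : ∀ m : ℕ, 1 ≤ m → m ≤ M →
      QuantizedConsensus.norm2 (QuantizedConsensus.matJsucc a A B K U γ₂ m) ≤
        QuantizedConsensus.specRadius (QuantizedConsensus.matJsucc a A B K U γ₂ 0) / C₂)
    (hθ₀ : Cx₀ * γ₁ / σ ≤ θ₀)
    (hlevels : QuantizedConsensus.normInf (Matrix.fromCols (-QuantizedConsensus.matL a B K)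
        (QuantizedConsensus.matH a A B K)) * QuantizedConsensus.constZeta a A B K γ₂ M *
        (√(QuantizedConsensus.constC1 a A B K γ₁ γ₂ d₀ C₂ M ^ 2 + (N : ℝ) * n) / γ₁) ≤
      2 * (R : ℝ) + 1) :
    let θ := QuantizedConsensus.theta D γ₁ γ₂ θ₀
    let x := fun k => (QuantizedConsensus.closedLoop D a A B K R σ γ₁ γ₂ θ₀ x₀ k).1
    let xhat := fun k => (QuantizedConsensus.closedLoop D a A B K R σ γ₁ γ₂ θ₀ x₀ k).2
    -- the argument of the quantizer stays in its range at every transmission attempt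
    (∀ (k : ℕ) (j : Fin N), ‖(θ k)⁻¹ • (x (k + 1) j - A *ᵥ xhat k j)‖ ≤ (2 * R + 1) * σ) ∧
    -- consensus
    (1 / T + Δ / τD < -Real.log γ₁ / (Real.log γ₂ - Real.log γ₁) →
      ∀ i : Fin N, Filter.Tendsto (fun k => ‖x k i - QuantizedConsensus.average (x k)‖)
        Filter.atTop (𝓝 0)) := by
  intro θ x xhat
  set J := matJsucc a A B K U γ₂
  have hd₀pos : 0 < d₀ := lt_of_le_of_lt ENNReal.toReal_nonneg hd₀
  have hγ₁pos : 0 < γ₁ := hd₀pos.trans hγ₁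
  have hθ₀pos : 0 < θ₀ := lt_of_lt_of_le (by positivity) hθ₀
  have hθpos : ∀ k, 0 < θ k := theta_pos D hγ₁pos hγ₂ hθ₀pos
  have hC₂pos : 0 < C₂ := zero_lt_one.trans_le hC₂
  set ν := √((N : ℝ) * n) with hν
  have hνnn : 0 ≤ ν := Real.sqrt_nonneg _
  set C₀ := constC0 a A B K γ₂ M
  set C₁ := constC1 a A B K γ₁ γ₂ d₀ C₂ M
  set ζ := constZeta a A B K γ₂ M
  have hC₀nn : 0 ≤ C₀ := constC0_nonneg a A B K γ₂ M
  have hζnn : 0 ≤ ζ := constZeta_nonneg a A B K γ₂ M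
  have hC₁init : C₂ * ν ≤ C₁ := by
    refine le_trans ?_ (le_max_left _ _)
    nlinarith [mul_nonneg hC₂pos.le hνnn]
  -- Self-reproduction of the bound: contraction by `d₀` plus the input must fit under the shrinking
  -- of the scaling parameter by `γ₁`. This dictates the second term of `C₁`.
  have hC₁step : d₀ * C₁ + C₂ * (C₀ * ν) ≤ γ₁ * C₁ := by
    have h : C₀ * C₂ * ν / ((1 - d₀ / γ₁) * γ₁) ≤ C₁ := le_max_right _ _
    have e : (1 - d₀ / γ₁) * γ₁ = γ₁ - d₀ := by field_simp
    rw [e, div_le_iff₀ (by linarith)] at h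
    linarith
  have hJpow : ∀ p : ℕ, norm2 (J 0 ^ p) ≤ C₂ * d₀ ^ p := by
    intro p
    rcases Nat.eq_zero_or_pos p with rfl | hp
    · simpa using norm2_one_le.trans hC₂
    · exact hpow p hp
  have hJ' : ∀ m, 1 ≤ m → m ≤ M → norm2 (J m) ≤ d₀ / C₂ := fun m h1 h2 =>
    (hJ m h1 h2).trans (by gcongr)
  obtain ⟨hV, hVt⟩ := norm2_le_one_of_transpose_mul_self
    (disagreementBasis_transpose_mul_self (n := n) hU.orthogonal)
  have hVle : ∀ v, euclNorm (disagreementBasis n U *ᵥ v) ≤ euclNorm v := fun v =>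
    (euclNorm_mulVec_le _ _).trans (mul_le_of_le_one_left (euclNorm_nonneg _) hV)
  have hVtle : ∀ v, euclNorm ((disagreementBasis n U)ᵀ *ᵥ v) ≤ euclNorm v := fun v =>
    (euclNorm_mulVec_le _ _).trans (mul_le_of_le_one_left (euclNorm_nonneg _) hVt)
  have hproj : ∀ y : Fin N → Fin n → ℝ, stack (deviation y) =
      disagreementBasis n U *ᵥ ((disagreementBasis n U)ᵀ *ᵥ stack y) := fun y => by
    rw [Matrix.mulVec_mulVec, disagreementBasis_mul_transpose_mulVec hU]
  have hcoord : ∀ y : Fin N → Fin n → ℝ, (disagreementBasis n U)ᵀ *ᵥ stack (deviation y) =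
      (disagreementBasis n U)ᵀ *ᵥ stack y := fun y => by
    rw [hproj, Matrix.mulVec_mulVec, disagreementBasis_transpose_mul_self hU.orthogonal,
      Matrix.one_mulVec]
  set z : ℕ → (Fin N × Fin n) ⊕ (Fin N × Fin n) → ℝ := fun k =>
    Sum.elim (stack (deviation (x k))) (stack (x k - xhat k)) with hz
  -- Division by `γ₁` undoes the last update: right after a success, `b k` is `σ` times the previous
  -- scaling parameter, the quantization error bound.
  set b : ℕ → ℝ := fun k => σ / γ₁ * θ k with hb
  have hbpos : ∀ k, 0 < b k := fun k => mul_pos (by positivity) (hθpos k)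
  have hzbound : ∀ s m, m ≤ M → z (s + m) = matAbar a A B K ^ m *ᵥ z s →
      θ (s + m) = γ₂ ^ m * θ s →
      DecaysFrom J M d₀ (C₁ * b s) ((disagreementBasis n U)ᵀ *ᵥ stack (deviation (x s))) →
      (∀ i, ‖x s i - xhat s i‖ ≤ b s) →
      euclNorm (z (s + m)) ≤ ζ * √(C₁ ^ 2 + (N : ℝ) * n) * b (s + m) := by
    intro s m hm hzs hθs hα he
    have h1 : euclNorm (stack (deviation (x s))) ≤ C₁ * b s := by
      rw [hproj, ← hcoord]
      exact (hVle _).trans hα.euclNorm_le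
    have h2 : euclNorm (stack (x s - xhat s)) ≤ ν * b s := euclNorm_stack_le (hbpos s).le he
    have h3 : euclNorm (z s) ≤ √(C₁ ^ 2 + (N : ℝ) * n) * b s := by
      refine (euclNorm_sumElim_le h1 h2).trans (le_of_eq ?_)
      rw [mul_pow C₁, mul_pow ν, hν, Real.sq_sqrt (by positivity), ← add_mul,
        Real.sqrt_mul (by positivity), Real.sqrt_sq (hbpos s).le]
    calc euclNorm (z (s + m)) ≤ ζ * γ₂ ^ m * euclNorm (z s) := by
          rw [hzs]
          exact euclNorm_matAbar_pow_mulVec_le a A B K hγ₂ hm _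
      _ ≤ ζ * γ₂ ^ m * (√(C₁ ^ 2 + (N : ℝ) * n) * b s) := by gcongr
      _ = ζ * √(C₁ ^ 2 + (N : ℝ) * n) * b (s + m) := by
          simp only [hb, hθs]
          ring
  have hrange : ∀ k, euclNorm (z k) ≤ ζ * √(C₁ ^ 2 + (N : ℝ) * n) * b k →
      ∀ j, ‖(θ k)⁻¹ • (x (k + 1) j - A *ᵥ xhat k j)‖ ≤ (2 * R + 1) * σ := by
    intro k hk j
    rw [norm_smul, norm_inv, Real.norm_of_nonneg (hθpos k).le, inv_mul_le_iff₀ (hθpos k)]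
    calc ‖x (k + 1) j - A *ᵥ xhat k j‖
        ≤ normInf (Matrix.fromCols (-matL a B K) (matH a A B K)) * euclNorm (z k) :=
          norm_error_step_le A B K ha (x k) (xhat k) j
      _ ≤ normInf (Matrix.fromCols (-matL a B K) (matH a A B K)) *
          (ζ * √(C₁ ^ 2 + (N : ℝ) * n) * b k) :=
          mul_le_mul_of_nonneg_left hk (normInf_nonneg _)
      _ = normInf (Matrix.fromCols (-matL a B K) (matH a A B K)) * ζ *
          (√(C₁ ^ 2 + (N : ℝ) * n) / γ₁) * (θ k * σ) := by
          simp only [hb]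
          ring
      _ ≤ (2 * (R : ℝ) + 1) * (θ k * σ) :=
          mul_le_mul_of_nonneg_right hlevels (mul_pos (hθpos k) hσ).le
      _ = θ k * ((2 * R + 1) * σ) := by ring
  -- Here `s` is the last success (or time zero) and `m` counts the failures since. A failure only
  -- increments `m`; a success restarts with `m = 0`.
  have hinv : ∀ k, ∃ s m, k = s + m ∧ (∀ i, s < i → i ≤ s + m → D.Fails i) ∧
      z k = matAbar a A B K ^ m *ᵥ z s ∧ θ k = γ₂ ^ m * θ s ∧
      DecaysFrom J M d₀ (C₁ * b s) ((disagreementBasis n U)ᵀ *ᵥ stack (deviation (x s))) ∧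
      ∀ i, ‖x s i - xhat s i‖ ≤ b s := by
    intro k
    induction k with
    | zero =>
      have hCb : Cx₀ ≤ b 0 := by
        have h := mul_le_mul_of_nonneg_left hθ₀ (by positivity : 0 ≤ σ / γ₁)
        have e : σ / γ₁ * (Cx₀ * γ₁ / σ) = Cx₀ := by field_simp
        rw [e] at h
        exact h
      have hx : ∀ i, ‖x 0 i‖ ≤ b 0 := fun i => (hx₀ i).trans hCb
      refine ⟨0, 0, rfl, fun i _ _ => by omega, by simp, by simp, ?_, ?_⟩
      · rw [hcoord]
        have h := DecaysFrom.of_euclNorm_le hd₀pos.le hC₂ hJpow hJ'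
          ((hVtle _).trans (euclNorm_stack_le (hbpos 0).le hx))
        refine h.mono hd₀pos.le ?_
        rw [← mul_assoc]
        exact mul_le_mul_of_nonneg_right hC₁init (hbpos 0).le
      · intro i
        have h0 : xhat 0 i = 0 := rfl
        rw [h0, sub_zero]
        exact hx i
    | succ k ih =>
      obtain ⟨s, m, rfl, hfail, hzs, hθs, hα, he⟩ := ih
      have hmM : m ≤ M := hM ▸ D.le_maxFail hΔ hfreq hdur hDoS hfail
      by_cases hF : D.Fails (s + m + 1)
      · refine ⟨s, m + 1, rfl, ?_, ?_, ?_, hα, he⟩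
        · intro i h1 h2
          rcases Nat.lt_or_ge (s + m) i with h | h
          · rwa [show i = s + m + 1 by omega]
          · exact hfail i h1 h
        · rw [pow_succ', ← Matrix.mulVec_mulVec, ← hzs]
          have hxh : xhat (s + m + 1) = fun j => A *ᵥ xhat (s + m) j :=
            closedLoop_snd_succ_of_fails hF
          simp only [hz]
          rw [hxh]
          exact sumElim_step A B K ha (x (s + m)) (xhat (s + m))
        · rw [pow_succ', mul_assoc, ← hθs]
          exact theta_succ_of_fails D hF
      · have hθ' : θ (s + m + 1) = γ₁ * θ (s + m) := theta_succ_of_not_fails D hF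
        have hb' : b (s + m + 1) = σ * θ (s + m) := by
          simp only [hb, hθ']
          field_simp
        refine ⟨s + m + 1, 0, rfl, fun i _ _ => by omega, by simp, by simp, ?_, ?_⟩
        · have hdev : stack (deviation (x (s + m + 1))) =
              Matrix.fromCols (matG a A B K) (matL a B K) *ᵥ z (s + m) := by
            rw [Matrix.fromCols_mulVec_sumElim]
            exact stack_deviation_step A B K ha (x (s + m)) (xhat (s + m))
          have hn : euclNorm ((disagreementBasis n U)ᵀ *ᵥ
              (matLsucc a A B K γ₂ m *ᵥ stack (x s - xhat s))) ≤ C₀ * (ν * b s) := by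
            refine (hVtle _).trans ((euclNorm_mulVec_le _ _).trans ?_)
            exact mul_le_mul (norm2_matLsucc_le a A B K γ₂ hmM)
              (euclNorm_stack_le (hbpos s).le he) (euclNorm_nonneg _) hC₀nn
          rw [hdev, hzs]
          simp only [hz]
          -- The factor `γ₂ ^ m` is also the growth of the scaling parameter during the failures, so
          -- it cancels against `b`.
          rw [disagreement_step A B K hU hγ₂.ne']
          refine DecaysFrom.mono hd₀pos.le (DecaysFrom.smul (by positivity)
            ((hα.mulVec hmM).add (DecaysFrom.of_euclNorm_le hd₀pos.le hC₂ hJpow hJ' hn))) ?_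
          have e : C₁ * b (s + m + 1) = γ₂ ^ m * (γ₁ * C₁ * b s) := by
            rw [hb', hθs]
            simp only [hb]
            field_simp
          rw [e]
          refine mul_le_mul_of_nonneg_left ?_ (by positivity)
          have := mul_le_mul_of_nonneg_right hC₁step (hbpos s).le
          linarith
        · intro i
          have hxh : xhat (s + m + 1) = fun j => A *ᵥ xhat (s + m) j + θ (s + m) •
              quantVec R σ ((θ (s + m))⁻¹ • (x (s + m + 1) j - A *ᵥ xhat (s + m) j)) :=
            closedLoop_snd_succ_of_not_fails hF
          rw [hxh, hb', ← sub_sub]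
          exact norm_sub_smul_quantVec_le hσ (hθpos _)
            (hrange _ (hzbound s m hmM hzs hθs hα he) i)
  have hzk : ∀ k, euclNorm (z k) ≤ ζ * √(C₁ ^ 2 + (N : ℝ) * n) * b k := by
    intro k
    obtain ⟨s, m, rfl, hfail, hzs, hθs, hα, he⟩ := hinv k
    exact hzbound s m (hM ▸ D.le_maxFail hΔ hfreq hdur hDoS hfail) hzs hθs hα he
  refine ⟨fun k => hrange k (hzk k), fun hrate i => ?_⟩
  have hθlim := tendsto_theta D hΔ hτD hT hfreq hdur hγ₁pos hγ₁' hγ₂ hθ₀pos hrate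
  refine squeeze_zero (fun k => norm_nonneg _) (fun k => ?_)
    (g := fun k => ζ * √(C₁ ^ 2 + (N : ℝ) * n) * (σ / γ₁) * θ k)
    (by simpa only [mul_zero] using hθlim.const_mul (ζ * √(C₁ ^ 2 + (N : ℝ) * n) * (σ / γ₁)))
  have h1 : euclNorm (stack (deviation (x k))) ≤ euclNorm (z k) := by
    rw [euclNorm_eq_sqrt, euclNorm_eq_sqrt, Fintype.sum_sum_type]
    exact Real.sqrt_le_sqrt (le_add_of_nonneg_right (Finset.sum_nonneg fun _ _ => sq_nonneg _))
  calc ‖x k i - average (x k)‖ ≤ euclNorm (stack (deviation (x k))) :=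
        norm_le_euclNorm_stack (deviation (x k)) i
    _ ≤ ζ * √(C₁ ^ 2 + (N : ℝ) * n) * b k := h1.trans (hzk k)
    _ = _ := by
        simp only [hb]
        ring
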